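/- For a group $G$, a subset $S\subseteq G$ is called *elementary algebraic* if there are an integer $n>0$, elements $a_1,\dots,a_n\in G$ and $\varepsilon_1,\dots,\varepsilon_n\in\{-1,1\}$ such that $S=\{x\in G: x^{\varepsilon_1}a_1x^{\varepsilon_2}a_2\cdots a_{n-1}x^{\varepsilon_n}=a_n\}$; it is called *algebraic* if it is an intersection of finite (possibly empty) unions of elementary algebraic subsets of $G$; and it is called *unconditionally closed* if it is closed in every Hausdorff group topology on $G$. The *Zariski topology* $\mathfrak Z_G$ is the topology on $G$ whose closed sets are exactly the algebraic subsets, and the *Markov topology* $\mathfrak M_G$ is the intersection of all Hausdorff group topologies on $G$, so that its closed sets are exactly the unconditionally closed subsets. For a family $(G_i)_{i\in I}$ of (not necessarily Abelian) groups, $\bigoplus_{i\in I}G_i$ denotes the group of all $g\in\prod_{i\in I}G_i$ such that $\{i\in I: g(i)\neq 1\}$ is finite, with coordinatewise operations. **Corollary.** Let $N$ be an Abelian group, let $(G_i)_{i\in I}$ be a family of countable (possibly finite) groups indexed by an arbitrary set $I$, and let $G=N\times\bigoplus_{i\in I}G_i$. Then $\mathfrak M_G=\mathfrak Z_G$; in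 particular, every unconditionally closed subset of $G$ is algebraic. The same two conclusions hold for the direct sum $\bigoplus_{i\in I}G_i$ itself in place of $G$. -/

import Mathlib

open scoped Topology

/-- `S ⊆ G` is elementary algebraic if, for some `n = m + 1 > 0`, some `a₁, …, aₙ ∈ G` and some
`ε₁, …, εₙ ∈ {-1, 1}`, it is the set of solutions `x` of
`x ^ ε₁ * a₁ * x ^ ε₂ * a₂ * ⋯ * aₙ₋₁ * x ^ εₙ = aₙ`.
The indices `1, …, n` are represented by `Fin (m + 1)`, that is by `0, …, m`. -/
def IsElementaryAlgebraicSet {G : Type*} [Group G] (S : Set G) : Prop :=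
  ∃ (m : ℕ) (a : Fin (m + 1) → G) (ε : Fin (m + 1) → ℤ),
    (∀ i, ε i = -1 ∨ ε i = 1) ∧
    S = {x : G | x ^ ε 0 * (List.ofFn fun i : Fin m => a i.castSucc * x ^ ε i.succ).prod
      = a (Fin.last m)}

/-- `S` is the union of a finite (possibly empty) family of elementary algebraic sets. -/
def IsFiniteUnionOfElementaryAlgebraicSets {G : Type*} [Group G] (S : Set G) : Prop :=
  ∃ E : Set (Set G), E.Finite ∧ (∀ A ∈ E, IsElementaryAlgebraicSet A) ∧ S = ⋃₀ E

/-- `S` is algebraic if it is an intersection of finite unions of elementary algebraic sets. -/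
def IsAlgebraicSet {G : Type*} [Group G] (S : Set G) : Prop :=
  ∃ F : Set (Set G), (∀ A ∈ F, IsFiniteUnionOfElementaryAlgebraicSets A) ∧ S = ⋂₀ F

/-- `S` is unconditionally closed if it is closed in every Hausdorff group topology of `G`. -/
def IsUnconditionallyClosed {G : Type*} [Group G] (S : Set G) : Prop :=
  ∀ t : TopologicalSpace G, @IsTopologicalGroup G t _ → @T2Space G t → IsClosed[t] S

theorem IsAlgebraicSet.empty {G : Type*} [Group G] : IsAlgebraicSet (∅ : Set G) :=
  ⟨{∅}, by
    rintro A rfl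
    exact ⟨∅, Set.finite_empty, by simp, by simp⟩, by simp⟩

theorem IsAlgebraicSet.sInter {G : Type*} [Group G] (A : Set (Set G))
    (hA : ∀ S ∈ A, IsAlgebraicSet S) : IsAlgebraicSet (⋂₀ A) := by
  refine ⟨{B | IsFiniteUnionOfElementaryAlgebraicSets B ∧ ∃ S ∈ A, S ⊆ B},
    fun B hB => hB.1, Set.Subset.antisymm ?_ ?_⟩
  · rintro x hx B ⟨-, S, hS, hSB⟩
    exact hSB (hx S hS)
  · intro x hx S hS
    obtain ⟨F, hF, rfl⟩ := hA S hS
    intro B hB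
    exact hx B ⟨hF B hB, _, hS, Set.sInter_subset_of_mem hB⟩

theorem IsAlgebraicSet.union {G : Type*} [Group G] {S T : Set G}
    (hS : IsAlgebraicSet S) (hT : IsAlgebraicSet T) : IsAlgebraicSet (S ∪ T) := by
  obtain ⟨F, hF, rfl⟩ := hS
  obtain ⟨F', hF', rfl⟩ := hT
  refine ⟨{C | ∃ A ∈ F, ∃ B ∈ F', C = A ∪ B}, ?_, ?_⟩
  · rintro C ⟨A, hA, B, hB, rfl⟩
    obtain ⟨E, hE, hE', rfl⟩ := hF A hA
    obtain ⟨D, hD, hD', rfl⟩ := hF' B hB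
    refine ⟨E ∪ D, hE.union hD, ?_, (Set.sUnion_union E D).symm⟩
    rintro X (hX | hX)
    · exact hE' X hX
    · exact hD' X hX
  · ext x
    constructor
    · rintro (hx | hx) C ⟨A, hA, B, hB, rfl⟩
      · exact Or.inl (hx A hA)
      · exact Or.inr (hx B hB)
    · intro hx
      by_contra hcon
      simp only [Set.mem_union, Set.mem_sInter, not_or, not_forall] at hcon
      obtain ⟨⟨A, hA, hxA⟩, B, hB, hxB⟩ := hcon
      rcases hx _ ⟨A, hA, B, hB, rfl⟩ with h | h
      · exact hxA h
      · exact hxB h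

/-- The Zariski topology of a group: its closed sets are the algebraic sets. -/
@[reducible] def groupZariskiTopology (G : Type*) [Group G] : TopologicalSpace G :=
  TopologicalSpace.ofClosed {S : Set G | IsAlgebraicSet S} IsAlgebraicSet.empty
    (fun A hA => IsAlgebraicSet.sInter A fun _ hS => hA hS)
    (fun _ hS _ hT => hS.union hT)

/-- The Markov topology of a group: the intersection of all Hausdorff group topologies. In Mathlib
topologies are ordered by reverse inclusion of the families of open sets, so this infimum in the
inclusion order is written `sSup`. -/
@[reducible] def groupMarkovTopology (G : Type*) [Group G] : TopologicalSpace G :=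
  sSup {t : TopologicalSpace G | @IsTopologicalGroup G t _ ∧ @T2Space G t}

theorem isClosed_groupZariskiTopology_iff {G : Type*} [Group G] {S : Set G} :
    IsClosed[groupZariskiTopology G] S ↔ IsAlgebraicSet S := by
  rw [← @isOpen_compl_iff G S (groupZariskiTopology G)]
  change IsAlgebraicSet Sᶜᶜ ↔ _
  rw [compl_compl]

theorem isClosed_groupMarkovTopology_iff {G : Type*} [Group G] {S : Set G} :
    IsClosed[groupMarkovTopology G] S ↔ IsUnconditionallyClosed S := by
  rw [groupMarkovTopology, isClosed_sSup_iff]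
  exact ⟨fun h t h₁ h₂ => h t ⟨h₁, h₂⟩, fun h t ht => h t ht.1 ht.2⟩

/-- The direct sum of a family of (not necessarily commutative) groups: the subgroup of the
Cartesian product that consists of the functions `g` such that `{i | g i ≠ 1}` is finite. -/
def groupDirectSum {I : Type*} (G : I → Type*) [∀ i, Group (G i)] : Subgroup (∀ i, G i) where
  carrier := {g | {i | g i ≠ 1}.Finite}
  one_mem' := by simp
  mul_mem' := by
    intro g h hg hh
    refine (Set.Finite.union hg hh).subset fun i hi => ?_
    by_contra hcon
    simp only [Set.mem_union, Set.mem_ofPred_eq, not_or, not_not] at hcon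
    exact hi (by simp [hcon.1, hcon.2])
  inv_mem' := by
    intro g hg
    simpa using hg

/-!
Solution sets of word equations are closed in every Hausdorff group topology, so the point is that an
unconditionally closed set `S` is algebraic. Suppose that it is not, and choose `x ∉ S` lying in every
algebraic set that contains `S`. A Hausdorff group topology is constructed in which `x` belongs to the
closure of `S`.

*What non-algebraicity provides.* A word function is a map `F : G → G` built from constants and the
identity by the group operations, and `{y | F y = 1}` is algebraic. Hence for finitely many word
functions `F` there is `y` with `x * y ∈ S` such that `F y ≠ 1` for every `F` in the list with
`F 1 ≠ 1` (`exists_mem_forall_wordFunction_ne_one`).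

*Reflection to a countable subgroup.* Closing off under countably many choices of such `y` yields a
countable subgroup `H` that contains enough of them. In a product of a commutative group with a direct
sum of countable groups, `H` may also be taken to contain every element of the direct sum that is
supported in the supports of finitely many members of `H`. Then conjugation by any `g ∈ G` agrees on
`H` with conjugation by an element of `H`, namely the restriction of `g` to the (countable) union of
the supports (`exists_mem_conj_eq`).

*Markov's theorem for `H`.* With `H = {x₀, x₁, …}`, a sequence `s₀, s₁, …` in `H ∩ x⁻¹ S` is chosen
together with finite sets `B₀ ⊆ B₁ ⊆ …` exhausting `H`. A conjugate `h * s j ^ (±1) * h⁻¹` with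
`h ∈ B i` and `i ≤ j` gets the weight `2 ^ (i - j)`, and the basic neighbourhoods of `1` are the sets
`U k` of products of total weight less than `2⁻ᵏ`. Products of such products, inverses and
conjugates (by `G`, not only by `H`) are under control by the choice of the weights, and `s j` tends
to `1`. The topology is Hausdorff because `x k ∉ U k` whenever `x k ≠ 1`: in a product
of weight less than `2⁻ᵏ`, let `m` be the largest index of an `s j` that occurs. The product is then the
value at `s m` of one of finitely many word functions determined by `s₀, …, s₍ₘ₋₁₎`, whose value at `1`
is a product of no larger weight with smaller indices, hence differs from `x k` by induction;
and `s m` was chosen to preserve all these inequalities (`prod_ne_of_conjTerms`).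
-/

open scoped Pointwise

/-! ### Word functions and algebraic sets -/

section WordFunctions

variable {G : Type*} [Group G]

/-- The group of word functions `x ↦ c₀ * x ^ ε₁ * c₁ * ⋯ * x ^ εₙ * cₙ` of `G`, as the subgroup
of the pointwise group `G → G` generated by the constants and the identity map. -/
def wordFunctions (G : Type*) [Group G] : Subgroup (G → G) :=
  Subgroup.closure (Set.range (Function.const G) ∪ {id})

theorem const_mem_wordFunctions (a : G) : Function.const G a ∈ wordFunctions G :=
  Subgroup.subset_closure (Or.inl ⟨a, rfl⟩)

theorem id_mem_wordFunctions : (id : G → G) ∈ wordFunctions G :=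
  Subgroup.subset_closure (Or.inr rfl)

theorem comp_mem_wordFunctions {F E : G → G} (hF : F ∈ wordFunctions G)
    (hE : E ∈ wordFunctions G) : F ∘ E ∈ wordFunctions G := by
  induction hF using Subgroup.closure_induction with
  | mem F hF =>
    rcases hF with ⟨a, rfl⟩ | hF
    · exact const_mem_wordFunctions a
    · rw [Set.mem_singleton_iff.1 hF]
      exact hE
  | one => exact one_mem _
  | mul F₁ F₂ _ _ h₁ h₂ => exact mul_mem h₁ h₂
  | inv F _ h => exact inv_mem h

/-- `F x` is a word in `x` that involves `x` at least once, of the shape used by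
`IsElementaryAlgebraicSet` up to the outer coefficients `c` and `a m`. The word need not be
reduced: coefficients between opposite powers of `x` may be `1`. -/
def HasWordForm (F : G → G) : Prop :=
  ∃ (m : ℕ) (a : Fin (m + 1) → G) (ε : Fin (m + 1) → ℤ) (c : G), (∀ i, ε i = -1 ∨ ε i = 1) ∧
    ∀ x, F x = c * (x ^ ε 0 * (List.ofFn fun i : Fin m => a i.castSucc * x ^ ε i.succ).prod)
      * a (Fin.last m)

theorem HasWordForm.const_mul {F : G → G} (hF : HasWordForm F) (b : G) :
    HasWordForm (Function.const G b * F) := by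
  obtain ⟨m, a, ε, c, hε, h⟩ := hF
  exact ⟨m, a, ε, b * c, hε, fun x => by simp [h, mul_assoc]⟩

theorem HasWordForm.zpow_mul {F : G → G} (hF : HasWordForm F) {δ : ℤ}
    (hδ : δ = -1 ∨ δ = 1) : HasWordForm (fun x => x ^ δ * F x) := by
  obtain ⟨m, a, ε, c, hε, h⟩ := hF
  refine ⟨m + 1, Fin.cons c a, Fin.cons δ ε, 1, Fin.cases hδ hε, fun x => ?_⟩
  rw [List.ofFn_succ]
  simp [h, mul_assoc, ← Fin.succ_last]

theorem hasWordForm_zpow {δ : ℤ} (hδ : δ = -1 ∨ δ = 1) (b : G) :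
    HasWordForm (fun x : G => x ^ δ * b) :=
  ⟨0, fun _ => b, fun _ => δ, 1, fun _ => hδ, fun x => by simp⟩

theorem const_or_hasWordForm {F : G → G} (hF : F ∈ wordFunctions G) :
    (∃ b, F = Function.const G b) ∨ HasWordForm F := by
  have key : ∀ {δ : ℤ}, (δ = -1 ∨ δ = 1) → ∀ F : G → G,
      ((∃ b, F = Function.const G b) ∨ HasWordForm F) →
      HasWordForm (fun x => x ^ δ * F x) := by
    rintro δ hδ F (⟨b, rfl⟩ | h)
    · exact hasWordForm_zpow hδ b
    · exact h.zpow_mul hδ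
  have key' : ∀ (a : G) (F : G → G),
      ((∃ b, F = Function.const G b) ∨ HasWordForm F) →
      (∃ b, Function.const G a * F = Function.const G b) ∨
        HasWordForm (Function.const G a * F) := by
    rintro a F (⟨b, rfl⟩ | h)
    · exact Or.inl ⟨a * b, rfl⟩
    · exact Or.inr (h.const_mul a)
  induction hF using Subgroup.closure_induction_left with
  | one => exact Or.inl ⟨1, rfl⟩
  | mul_left E hE F _ ih =>
    rcases hE with ⟨a, rfl⟩ | hE
    · exact key' a F ih
    · rw [Set.mem_singleton_iff.1 hE]
      convert Or.inr (key (Or.inr rfl) F ih) using 2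
      ext x
      simp
  | inv_mul_cancel E hE F _ ih =>
    rcases hE with ⟨a, rfl⟩ | hE
    · exact key' a⁻¹ F ih
    · rw [Set.mem_singleton_iff.1 hE]
      convert Or.inr (key (Or.inl rfl) F ih) using 2
      ext x
      simp

theorem IsElementaryAlgebraicSet.isAlgebraicSet {S : Set G} (h : IsElementaryAlgebraicSet S) :
    IsAlgebraicSet S :=
  ⟨{S}, by
    rintro A rfl
    exact ⟨{A}, Set.finite_singleton A, by rintro B rfl; exact h, by simp⟩, by simp⟩

theorem IsAlgebraicSet.univ : IsAlgebraicSet (Set.univ : Set G) :=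
  ⟨∅, by simp, by simp⟩

theorem isAlgebraicSet_wordFunction_eq_one {F : G → G} (hF : F ∈ wordFunctions G) :
    IsAlgebraicSet {x | F x = 1} := by
  rcases const_or_hasWordForm hF with ⟨b, rfl⟩ | ⟨m, a, ε, c, hε, h⟩
  · by_cases hb : b = 1
    · simpa [hb] using IsAlgebraicSet.univ
    · simpa [hb] using IsAlgebraicSet.empty
  · refine IsElementaryAlgebraicSet.isAlgebraicSet
      ⟨m, Fin.snoc (fun i : Fin m => a i.castSucc) (c⁻¹ * (a (Fin.last m))⁻¹), ε, hε, ?_⟩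
    ext x
    simp only [h, Set.mem_ofPred_eq, Fin.snoc_castSucc, Fin.snoc_last]
    rw [mul_eq_one_iff_eq_inv, ← eq_inv_mul_iff_mul_eq]

theorem isAlgebraicSet_biUnion {ι : Type*} {D : Set ι} (hD : D.Finite) {f : ι → Set G}
    (hf : ∀ i ∈ D, IsAlgebraicSet (f i)) : IsAlgebraicSet (⋃ i ∈ D, f i) := by
  induction D, hD using Set.Finite.induction_on with
  | empty => simpa using IsAlgebraicSet.empty
  | insert _ _ ih =>
    rw [Set.biUnion_insert]
    exact (hf _ (Set.mem_insert _ _)).union (ih fun i hi => hf i (Set.mem_insert_of_mem _ hi))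

theorem exists_notMem_forall_algebraic {S : Set G} (hS : ¬ IsAlgebraicSet S) :
    ∃ x ∉ S, ∀ T, IsAlgebraicSet T → S ⊆ T → x ∈ T := by
  by_contra! hcon
  refine hS ?_
  convert IsAlgebraicSet.sInter {T | IsAlgebraicSet T ∧ S ⊆ T} fun T hT => hT.1
  refine (Set.subset_sInter fun T hT => hT.2).antisymm fun x hx => ?_
  by_contra hxS
  obtain ⟨T, hT, hST, hxT⟩ := hcon x hxS
  exact hxT (hx T ⟨hT, hST⟩)

/-- If `x` is in the Zariski closure of `S`, then `x⁻¹ * S` has a member that preserves any finite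
number of word inequalities satisfied by `1`. -/
theorem exists_mem_forall_wordFunction_ne_one {S : Set G} {x : G}
    (hx : ∀ T, IsAlgebraicSet T → S ⊆ T → x ∈ T) {D : Set (G → G)} (hD : D.Finite)
    (hDw : D ⊆ wordFunctions G) :
    ∃ s, x * s ∈ S ∧ ∀ F ∈ D, F 1 ≠ 1 → F s ≠ 1 := by
  by_contra! hcon
  have hT : IsAlgebraicSet (⋃ F ∈ {F ∈ D | F 1 ≠ 1}, {y | F (x⁻¹ * y) = 1}) := by
    refine isAlgebraicSet_biUnion (hD.subset (Set.sep_subset _ _)) fun F hF => ?_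
    exact isAlgebraicSet_wordFunction_eq_one (comp_mem_wordFunctions (hDw hF.1)
      (mul_mem (const_mem_wordFunctions x⁻¹) id_mem_wordFunctions))
  have := hx _ hT fun y hy => by
    obtain ⟨F, hF, h1, h2⟩ := hcon (x⁻¹ * y) (by simpa using hy)
    exact Set.mem_biUnion (show F ∈ {F ∈ D | F 1 ≠ 1} from ⟨hF, h1⟩) h2
  obtain ⟨F, hF, hF1⟩ := Set.mem_iUnion₂.1 this
  exact hF.2 (by simpa using hF1)

theorem isClosed_of_isElementaryAlgebraicSet [TopologicalSpace G] [IsTopologicalGroup G]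
    [T2Space G] {S : Set G} (hS : IsElementaryAlgebraicSet S) : IsClosed S := by
  obtain ⟨m, a, ε, -, rfl⟩ := hS
  refine isClosed_eq (.mul (continuous_zpow _) ?_) continuous_const
  simp only [List.ofFn_eq_map]
  exact continuous_list_prod _ fun i _ => continuous_const.mul (continuous_zpow _)

theorem IsAlgebraicSet.isUnconditionallyClosed {S : Set G} (hS : IsAlgebraicSet S) :
    IsUnconditionallyClosed S := by
  intro t h₁ h₂
  obtain ⟨F, hF, rfl⟩ := hS
  refine isClosed_sInter fun A hA => ?_
  obtain ⟨E, hE, hE', rfl⟩ := hF A hA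
  rw [Set.sUnion_eq_biUnion]
  exact hE.isClosed_biUnion fun B hB => isClosed_of_isElementaryAlgebraicSet (hE' B hB)

end WordFunctions

/-! ### Topologies from weighted products -/

section WeightedProducts

variable {G : Type*}

/-- The total weight of a list of pairs `(d, a)`, where `(d, a)` has weight `2⁻ᵈ`. -/
noncomputable def listWeight (l : List (ℕ × G)) : ℝ :=
  (l.map fun p => (1 / 2 : ℝ) ^ p.1).sum

@[simp] theorem listWeight_nil : listWeight ([] : List (ℕ × G)) = 0 := rfl

@[simp] theorem listWeight_cons (p : ℕ × G) (l : List (ℕ × G)) :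
    listWeight (p :: l) = (1 / 2 : ℝ) ^ p.1 + listWeight l := by
  simp [listWeight]

@[simp] theorem listWeight_append (l l' : List (ℕ × G)) :
    listWeight (l ++ l') = listWeight l + listWeight l' := by
  simp [listWeight]

theorem listWeight_nonneg (l : List (ℕ × G)) : 0 ≤ listWeight l :=
  List.sum_nonneg (by simp only [List.mem_map]; rintro _ ⟨p, -, rfl⟩; positivity)

theorem pow_le_listWeight {l : List (ℕ × G)} {p : ℕ × G} (hp : p ∈ l) :
    (1 / 2 : ℝ) ^ p.1 ≤ listWeight l := by
  induction l with
  | nil => simp at hp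
  | cons q l ih =>
    rw [listWeight_cons]
    rcases List.mem_cons.1 hp with rfl | hp
    · linarith [listWeight_nonneg l]
    · have : (0 : ℝ) ≤ (1 / 2) ^ q.1 := by positivity
      linarith [ih hp]

theorem lt_of_listWeight_lt {l : List (ℕ × G)} {k : ℕ} (hl : listWeight l < (1 / 2 : ℝ) ^ k)
    {p : ℕ × G} (hp : p ∈ l) : k < p.1 :=
  (pow_lt_pow_iff_right_of_lt_one₀ (by norm_num) (by norm_num)).1
    ((pow_le_listWeight hp).trans_lt hl)

theorem length_mul_le_listWeight {l : List (ℕ × G)} {m : ℕ} (hl : ∀ p ∈ l, p.1 ≤ m) :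
    l.length * (1 / 2 : ℝ) ^ m ≤ listWeight l := by
  induction l with
  | nil => simp
  | cons q l ih =>
    have h₁ := ih fun p hp => hl p (List.mem_cons_of_mem _ hp)
    have h₂ : (1 / 2 : ℝ) ^ m ≤ (1 / 2) ^ q.1 :=
      pow_le_pow_of_le_one (by norm_num) (by norm_num) (hl q List.mem_cons_self)
    rw [listWeight_cons, List.length_cons]
    push_cast
    linarith

variable [Group G]

/-- The products of lists of elements of the sets `A d` of total weight less than `2⁻ᵏ`, where an
element taken from `A d` has weight `2⁻ᵈ`. -/
def smallProducts (A : ℕ → Set G) (k : ℕ) : Set G :=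
  {x | ∃ l : List (ℕ × G), (∀ p ∈ l, p.2 ∈ A p.1) ∧ listWeight l < (1 / 2 : ℝ) ^ k ∧
    (l.map Prod.snd).prod = x}

theorem one_mem_smallProducts (A : ℕ → Set G) (k : ℕ) : 1 ∈ smallProducts A k :=
  ⟨[], by simp, by simp, rfl⟩

theorem smallProducts_anti (A : ℕ → Set G) : Antitone (smallProducts A) := by
  rintro k m hkm x ⟨l, hl, hw, rfl⟩
  exact ⟨l, hl, hw.trans_le (pow_le_pow_of_le_one (by norm_num) (by norm_num) hkm), rfl⟩

theorem smallProducts_mul_subset (A : ℕ → Set G) (k : ℕ) :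
    smallProducts A (k + 1) * smallProducts A (k + 1) ⊆ smallProducts A k := by
  rintro _ ⟨_, ⟨l, hl, hw, rfl⟩, _, ⟨l', hl', hw', rfl⟩, rfl⟩
  refine ⟨l ++ l', ?_, ?_, by simp⟩
  · intro p hp
    exact (List.mem_append.1 hp).elim (hl p) (hl' p)
  · rw [listWeight_append]
    rw [pow_succ] at hw hw'
    linarith

theorem inv_mem_smallProducts {A : ℕ → Set G} (hA : ∀ d, ∀ x ∈ A d, x⁻¹ ∈ A d) {k : ℕ} {x : G}
    (hx : x ∈ smallProducts A k) : x⁻¹ ∈ smallProducts A k := by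
  obtain ⟨l, hl, hw, rfl⟩ := hx
  refine ⟨(l.map fun p => (p.1, p.2⁻¹)).reverse, ?_, ?_, ?_⟩
  · simp only [List.mem_reverse, List.mem_map]
    rintro _ ⟨p, hp, rfl⟩
    exact hA _ _ (hl p hp)
  · simpa [listWeight, Function.comp_def] using hw
  · simp [List.prod_inv_reverse, Function.comp_def]

theorem conj_mem_smallProducts {A : ℕ → Set G} {g : G} {n : ℕ}
    (hA : ∀ d, ∀ x ∈ A (d + n), g * x * g⁻¹ ∈ A d) {k : ℕ} {x : G}
    (hx : x ∈ smallProducts A (k + n)) : g * x * g⁻¹ ∈ smallProducts A k := by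
  obtain ⟨l, hl, hw, rfl⟩ := hx
  have hn : ∀ p ∈ l, n ≤ p.1 := fun p hp => by have := lt_of_listWeight_lt hw hp; omega
  refine ⟨l.map fun p => (p.1 - n, g * p.2 * g⁻¹), ?_, ?_, ?_⟩
  · simp only [List.mem_map]
    rintro _ ⟨p, hp, rfl⟩
    refine hA _ _ ?_
    rw [Nat.sub_add_cancel (hn p hp)]
    exact hl p hp
  · have : listWeight (l.map fun p => (p.1 - n, g * p.2 * g⁻¹)) * (1 / 2 : ℝ) ^ n
        = listWeight l := by
      rw [listWeight, listWeight, ← List.sum_map_mul_right, List.map_map]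
      congr 1
      refine List.map_congr_left fun p hp => ?_
      simp only [Function.comp]
      rw [← pow_add, Nat.sub_add_cancel (hn p hp)]
    rw [← this, pow_add] at hw
    exact lt_of_mul_lt_mul_right hw (by positivity)
  · clear hl hw hn
    induction l with
    | nil => simp
    | cons p l ih =>
      simp only [List.map_cons, List.prod_cons, ih]
      group

/-- A filtration of generators by weights that is compatible with inversion and conjugation and
whose small products separate points defines a Hausdorff group topology. -/
theorem exists_groupTopology_of_smallProducts {A : ℕ → Set G}
    (hinv : ∀ d, ∀ x ∈ A d, x⁻¹ ∈ A d)
    (hconj : ∀ g, ∃ n, ∀ d, ∀ x ∈ A (d + n), g * x * g⁻¹ ∈ A d)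
    (hsep : ∀ x, x ≠ 1 → ∃ k, x ∉ smallProducts A k) :
    ∃ t : TopologicalSpace G, @IsTopologicalGroup G t _ ∧ @T2Space G t ∧
      ∀ U ∈ @nhds G t 1, ∃ k, smallProducts A k ⊆ U := by
  let B : GroupFilterBasis G :=
    { sets := Set.range (smallProducts A)
      nonempty := Set.range_nonempty _
      inter_sets := by
        rintro _ _ ⟨k, rfl⟩ ⟨m, rfl⟩
        exact ⟨_, ⟨max k m, rfl⟩, Set.subset_inter (smallProducts_anti A (le_max_left _ _))
          (smallProducts_anti A (le_max_right _ _))⟩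
      one' := by
        rintro _ ⟨k, rfl⟩
        exact one_mem_smallProducts A k
      mul' := by
        rintro _ ⟨k, rfl⟩
        exact ⟨_, ⟨k + 1, rfl⟩, smallProducts_mul_subset A k⟩
      inv' := by
        rintro _ ⟨k, rfl⟩
        exact ⟨_, ⟨k, rfl⟩, fun x hx => inv_mem_smallProducts hinv hx⟩
      conj' := by
        rintro g _ ⟨k, rfl⟩
        obtain ⟨n, hn⟩ := hconj g
        exact ⟨_, ⟨k + n, rfl⟩, fun x hx => conj_mem_smallProducts hn hx⟩ }
  refine ⟨B.topology, B.isTopologicalGroup, ?_, fun U hU => ?_⟩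
  · refine (@GroupFilterBasis.t2Space_iff_sInter_subset G _ B.topology B rfl).2 fun x hx => ?_
    by_contra hx1
    obtain ⟨k, hk⟩ := hsep x hx1
    exact hk (hx _ ⟨k, rfl⟩)
  · obtain ⟨V, ⟨k, rfl⟩, hV⟩ := B.nhds_one_hasBasis.mem_iff.1 hU
    exact ⟨k, hV⟩

end WeightedProducts

/-! ### Markov's construction in a countable subgroup -/

section Sequence

variable {G : Type*} [Group G]

/-- The generators of the word functions with coefficients in `t`: the constants from `t`, the
identity and the inversion. The pointwise power `wordGenerators t ^ n` consists of words of length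
`n` in these. -/
def wordGenerators (t : Set G) : Set (G → G) :=
  Function.const G '' t ∪ {id, id⁻¹}

theorem finite_pow_wordGenerators {t : Set G} (ht : t.Finite) (n : ℕ) :
    (wordGenerators t ^ n).Finite := by
  induction n with
  | zero => simp
  | succ n ih =>
    rw [pow_succ]
    exact ih.mul ((ht.image _).union (by simp))

theorem pow_wordGenerators_subset (t : Set G) (n : ℕ) :
    wordGenerators t ^ n ⊆ wordFunctions G := by
  have h : wordGenerators t ⊆ wordFunctions G := by
    rintro F (⟨a, -, rfl⟩ | rfl | rfl)
    · exact const_mem_wordFunctions a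
    · exact id_mem_wordFunctions
    · exact inv_mem id_mem_wordFunctions
  induction n with
  | zero => simp [one_mem]
  | succ n ih =>
    rw [pow_succ]
    rintro _ ⟨F, hF, E, hE, rfl⟩
    exact mul_mem (ih hF) (h hE)

/-- The conjugates `h * s j ^ ε * h⁻¹` with `ε = ±1`, `j < m` and `h ∈ B i`, where `j = d + i`. -/
def conjTerms (B : ℕ → Set G) (s : ℕ → G) (m d : ℕ) : Set G :=
  {y | ∃ i, d + i < m ∧ ∃ h ∈ B i, y = h * s (d + i) * h⁻¹ ∨ y = h * (s (d + i))⁻¹ * h⁻¹}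

theorem conjTerms_mono (B : ℕ → Set G) (s : ℕ → G) {m m' : ℕ} (h : m ≤ m') (d : ℕ) :
    conjTerms B s m d ⊆ conjTerms B s m' d := by
  rintro y ⟨i, hi, hy⟩
  exact ⟨i, hi.trans_le h, hy⟩

variable {B : ℕ → Set G} {s : ℕ → G}

/-- A product of conjugates of `s₀ ^ (±1), …, s m ^ (±1)` is the value at `s m` of a word function with
coefficients in `B m`. Putting `1` for `s m` cancels the terms that involve `s m`, so the value at `1`
is a product of conjugates of earlier members of the sequence of at most the same weight. -/
theorem exists_wordFunction_of_list (hBmono : Monotone B)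
    (hBinv : ∀ i, ∀ b ∈ B i, b⁻¹ ∈ B i) (hs : ∀ j, s j ∈ B (j + 1)) (m : ℕ)
    (l : List (ℕ × G)) (hl : ∀ p ∈ l, p.2 ∈ conjTerms B s (m + 1) p.1) :
    ∃ F ∈ wordGenerators (B m) ^ (3 * l.length), ∃ l' : List (ℕ × G),
      (∀ p ∈ l', p.2 ∈ conjTerms B s m p.1) ∧ listWeight l' ≤ listWeight l ∧
      F (s m) = (l.map Prod.snd).prod ∧ F 1 = (l'.map Prod.snd).prod := by
  induction l with
  | nil => exact ⟨1, by simp, [], by simp⟩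
  | cons p l ih =>
    obtain ⟨F, hF, l', hl', hw, hFs, hF1⟩ := ih fun q hq => hl q (List.mem_cons_of_mem _ hq)
    have hcube : ∀ E₁ ∈ wordGenerators (B m), ∀ E₂ ∈ wordGenerators (B m),
        ∀ E₃ ∈ wordGenerators (B m),
        E₁ * E₂ * E₃ * F ∈ wordGenerators (B m) ^ (3 * (p :: l).length) := by
      intro E₁ h₁ E₂ h₂ E₃ h₃
      rw [List.length_cons, mul_add_one, add_comm, pow_add]
      refine Set.mul_mem_mul ?_ hF
      rw [pow_succ, pow_two]
      exact Set.mul_mem_mul (Set.mul_mem_mul h₁ h₂) h₃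
    have hc : ∀ b ∈ B m, Function.const G b ∈ wordGenerators (B m) :=
      fun b hb => Or.inl ⟨b, hb, rfl⟩
    have hp := hl p List.mem_cons_self
    obtain ⟨i, hi, h, hh, hy⟩ := hp
    have hhm : h ∈ B m := hBmono (by omega) hh
    have hpos : (0 : ℝ) ≤ (1 / 2) ^ p.1 := by positivity
    rcases (Nat.lt_succ_iff.1 hi).lt_or_eq with hlt | heq
    · have hsm : s (p.1 + i) ∈ B m := hBmono (by omega) (hs _)
      have hl'' : ∀ q ∈ p :: l', q.2 ∈ conjTerms B s m q.1 := by
        intro q hq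
        rcases List.mem_cons.1 hq with rfl | hq
        · exact ⟨i, hlt, h, hh, hy⟩
        · exact hl' q hq
      rcases hy with hy | hy
      · exact ⟨_, hcube _ (hc h hhm) _ (hc _ hsm) _ (hc _ (hBinv _ _ hhm)), p :: l', hl'',
          by simpa using hw, by simp [hFs, hy], by simp [hF1, hy]⟩
      · exact ⟨_, hcube _ (hc h hhm) _ (hc _ (hBinv _ _ hsm)) _ (hc _ (hBinv _ _ hhm)), p :: l',
          hl'', by simpa using hw, by simp [hFs, hy], by simp [hF1, hy]⟩
    · rw [heq] at hy
      have hw' : listWeight l' ≤ listWeight (p :: l) := by rw [listWeight_cons]; linarith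
      rcases hy with hy | hy
      · exact ⟨_, hcube _ (hc h hhm) id (Or.inr (Or.inl rfl)) _ (hc _ (hBinv _ _ hhm)), l', hl',
          hw', by simp [hFs, hy], by simp [hF1]⟩
      · exact ⟨_, hcube _ (hc h hhm) id⁻¹ (Or.inr (Or.inr rfl)) _ (hc _ (hBinv _ _ hhm)), l', hl',
          hw', by simp [hFs, hy], by simp [hF1]⟩

/-- Small products do not reach `x k`. In a product of weight less than `2⁻ᵏ` that
involves no member of `s` beyond `s m`, each term has weight at least `2⁻ᵐ`, so there are at most
`2 ^ m` terms; each is a product of three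
generators, and one more generator accounts for `(x k)⁻¹`. Hence `s m` has to respect the words of
length `3 * 2 ^ m + 1`. -/
theorem prod_ne_of_conjTerms {x : ℕ → G} (hB1 : ∀ i, 1 ∈ B i) (hBmono : Monotone B)
    (hBinv : ∀ i, ∀ b ∈ B i, b⁻¹ ∈ B i) (hs : ∀ j, s j ∈ B (j + 1)) (hx : ∀ k, x k ∈ B (k + 1))
    (hpick : ∀ m, ∀ F ∈ wordGenerators (B m) ^ (3 * 2 ^ m + 1), F 1 ≠ 1 → F (s m) ≠ 1)
    (m k : ℕ) (hk : x k ≠ 1) (l : List (ℕ × G)) (hl : ∀ p ∈ l, p.2 ∈ conjTerms B s m p.1)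
    (hw : listWeight l < (1 / 2 : ℝ) ^ k) : (l.map Prod.snd).prod ≠ x k := by
  induction m generalizing l with
  | zero =>
    cases l with
    | nil => simpa using hk.symm
    | cons p l =>
      obtain ⟨i, hi, -⟩ := hl p List.mem_cons_self
      omega
  | succ m ih =>
    rcases eq_or_ne l [] with rfl | hne
    · simpa using hk.symm
    have hlm : ∀ p ∈ l, p.1 ≤ m := fun p hp => by
      obtain ⟨i, hi, -⟩ := hl p hp
      omega
    have hkm : k < m := by
      obtain ⟨p, hp⟩ := List.exists_mem_of_ne_nil l hne
      exact (lt_of_listWeight_lt hw hp).trans_le (hlm p hp)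
    have hlen : l.length ≤ 2 ^ m := by
      have h₁ := length_mul_le_listWeight hlm
      have h₂ : (1 / 2 : ℝ) ^ k ≤ 1 := pow_le_one₀ (by norm_num) (by norm_num)
      have h₃ : l.length * (1 / 2 : ℝ) ^ m ≤ 1 := by linarith
      rw [one_div, inv_pow, ← div_eq_mul_inv, div_le_one (by positivity)] at h₃
      exact_mod_cast h₃
    obtain ⟨F, hF, l', hl', hw', hFs, hF1⟩ := exists_wordFunction_of_list hBmono hBinv hs m l hl
    have hone : (1 : G → G) ∈ wordGenerators (B m) := Or.inl ⟨1, hB1 m, rfl⟩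
    have hmem : F * Function.const G (x k)⁻¹ ∈ wordGenerators (B m) ^ (3 * 2 ^ m + 1) := by
      rw [pow_succ]
      exact Set.mul_mem_mul (Set.pow_subset_pow_right hone (by omega) hF)
        (Or.inl ⟨_, hBinv _ _ (hBmono hkm (hx k)), rfl⟩)
    have h := hpick m _ hmem (by
      simpa [hF1, mul_inv_eq_one] using ih l' hl' (hw'.trans_lt hw))
    simpa [hFs, mul_inv_eq_one] using h

/-- The Hausdorff group topology in Markov's theorem. The elements `g` outside the countable subgroup
`H` only have to act on `H` as inner automorphisms of `H`, so that the topology which makes `H` open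
is compatible with conjugation by `g`. -/
theorem exists_groupTopology_one_mem_closure {S : Set G} {H : Subgroup G}
    (hH : (H : Set G).Countable)
    (hinner : ∀ g, ∃ h ∈ H, ∀ y ∈ H, g * y * g⁻¹ = h * y * h⁻¹)
    (hpick : ∀ t : Set G, t.Finite → t ⊆ H → ∀ n : ℕ, ∃ y ∈ S, y ∈ H ∧
      ∀ F ∈ wordGenerators t ^ n, F 1 ≠ 1 → F y ≠ 1) :
    ∃ t : TopologicalSpace G, @IsTopologicalGroup G t _ ∧ @T2Space G t ∧
      ∀ U ∈ @nhds G t 1, (S ∩ U).Nonempty := by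
  obtain ⟨x, hx⟩ := hH.exists_eq_range ⟨1, one_mem H⟩
  have hxH : ∀ k, x k ∈ H := fun k => by
    rw [← SetLike.mem_coe, hx]
    exact ⟨k, rfl⟩
  choose! pick hpickS hpickH hpickF using hpick
  -- `B (m + 1)` is `C * C` with `C ⊇ B m`, so that left multiplication by `x k` maps `B i` into
  -- `B (i + k + 2)` and conjugation by `x k` costs only a bounded factor in weight.
  let C : ℕ → Set G → Set G := fun m b => b ∪ {x m, (x m)⁻¹, pick b (3 * 2 ^ m + 1),
    (pick b (3 * 2 ^ m + 1))⁻¹}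
  let B : ℕ → Set G := fun n => Nat.rec {1} (fun m b => C m b * C m b) n
  have hBsucc : ∀ m, B (m + 1) = C m (B m) * C m (B m) := fun m => rfl
  let s : ℕ → G := fun m => pick (B m) (3 * 2 ^ m + 1)
  have hB : ∀ m, 1 ∈ B m ∧ (∀ b ∈ B m, b⁻¹ ∈ B m) ∧ (B m).Finite ∧ B m ⊆ H := by
    intro m
    induction m with
    | zero => simp [B]
    | succ m ih =>
      obtain ⟨h1, hinv, hfin, hsub⟩ := ih
      have hsH : s m ∈ H := hpickH _ hfin hsub _
      have hC1 : 1 ∈ C m (B m) := Or.inl h1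
      have hCinv : ∀ b ∈ C m (B m), b⁻¹ ∈ C m (B m) := by
        rintro b (hb | rfl | rfl | rfl | rfl)
        · exact Or.inl (hinv b hb)
        · exact Or.inr (Or.inr (Or.inl rfl))
        · exact Or.inr (Or.inl (inv_inv _))
        · exact Or.inr (Or.inr (Or.inr (Or.inr rfl)))
        · exact Or.inr (Or.inr (Or.inr (Or.inl (inv_inv _))))
      have hCsub : C m (B m) ⊆ H := by
        rintro b (hb | rfl | rfl | rfl | rfl)
        · exact hsub hb
        · exact hxH m
        · exact inv_mem (hxH m)
        · exact hsH
        · exact inv_mem hsH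
      have hCfin : (C m (B m)).Finite := hfin.union (by simp)
      rw [hBsucc]
      refine ⟨⟨1, hC1, 1, hC1, one_mul 1⟩, ?_, hCfin.mul hCfin, ?_⟩
      · rintro _ ⟨a, ha, b, hb, rfl⟩
        exact ⟨b⁻¹, hCinv b hb, a⁻¹, hCinv a ha, (mul_inv_rev a b).symm⟩
      · rintro _ ⟨a, ha, b, hb, rfl⟩
        exact mul_mem (hCsub ha) (hCsub hb)
  have hC : ∀ m, C m (B m) ⊆ B (m + 1) := fun m b hb =>
    ⟨b, hb, 1, Or.inl (hB m).1, mul_one b⟩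
  have hBmono : Monotone B := monotone_nat_of_le_succ fun m => Set.subset_union_left.trans (hC m)
  have hsB : ∀ j, s j ∈ B (j + 1) := fun j => hC j (Or.inr (Or.inr (Or.inr (Or.inl rfl))))
  have hxB : ∀ k, x k ∈ B (k + 1) := fun k => hC k (Or.inr (Or.inl rfl))
  have hxmul : ∀ k i, ∀ h ∈ B i, x k * h ∈ B (i + k + 2) := by
    intro k i h hh
    have h₁ : x k ∈ C (i + k + 1) (B (i + k + 1)) := Or.inl
      (hBmono (show k + 1 ≤ i + k + 1 by omega) (hxB k))
    have h₂ : h ∈ C (i + k + 1) (B (i + k + 1)) := Or.inl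
      (hBmono (show i ≤ i + k + 1 by omega) hh)
    exact ⟨_, h₁, _, h₂, rfl⟩
  have hsH : ∀ j, s j ∈ H := fun j => (hB (j + 1)).2.2.2 (hsB j)
  let A : ℕ → Set G := fun d => {y | ∃ m, y ∈ conjTerms B s m d}
  have hAH : ∀ d, A d ⊆ H := by
    rintro d y ⟨m, i, -, h, hh, rfl | rfl⟩
    · exact mul_mem (mul_mem ((hB i).2.2.2 hh) (hsH _)) (inv_mem ((hB i).2.2.2 hh))
    · exact mul_mem (mul_mem ((hB i).2.2.2 hh) (inv_mem (hsH _))) (inv_mem ((hB i).2.2.2 hh))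
  have hAinv : ∀ d, ∀ y ∈ A d, y⁻¹ ∈ A d := by
    rintro d y ⟨m, i, hi, h, hh, rfl | rfl⟩
    · exact ⟨m, i, hi, h, hh, Or.inr (by group)⟩
    · exact ⟨m, i, hi, h, hh, Or.inl (by group)⟩
  have hAconj : ∀ g, ∃ n, ∀ d, ∀ y ∈ A (d + n), g * y * g⁻¹ ∈ A d := by
    intro g
    obtain ⟨h₀, hh₀, hg⟩ := hinner g
    obtain ⟨k, rfl⟩ : h₀ ∈ Set.range x := hx ▸ hh₀
    refine ⟨k + 2, fun d y hy => ?_⟩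
    rw [hg y (hAH _ hy)]
    obtain ⟨m, i, hi, h, hh, hy⟩ := hy
    -- The index of the conjugated member of `s` stays the same, while its conjugator moves from
    -- `B i` to `B (i + k + 2)`.
    have hidx : d + (k + 2) + i = d + (i + k + 2) := by omega
    rw [hidx] at hi hy
    refine ⟨m, i + k + 2, hi, x k * h, hxmul k i h hh, ?_⟩
    rcases hy with rfl | rfl
    · exact Or.inl (by group)
    · exact Or.inr (by group)
  have hsep : ∀ y, y ≠ 1 → ∃ k, y ∉ smallProducts A k := by
    intro y hy
    by_cases hyH : y ∈ H
    · obtain ⟨k, rfl⟩ : y ∈ Set.range x := hx ▸ hyH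
      refine ⟨k, ?_⟩
      rintro ⟨l, hl, hw, hprod⟩
      -- A finite list only involves finitely many members of the sequence `s`.
      obtain ⟨m, hm⟩ : ∃ m, ∀ p ∈ l, p.2 ∈ conjTerms B s m p.1 := by
        clear hw hprod
        induction l with
        | nil => exact ⟨0, by simp⟩
        | cons p l ih =>
          obtain ⟨m, hm⟩ := ih fun q hq => hl q (List.mem_cons_of_mem _ hq)
          obtain ⟨m', hm'⟩ := hl p List.mem_cons_self
          refine ⟨max m m', fun q hq => ?_⟩
          rcases List.mem_cons.1 hq with rfl | hq
          · exact conjTerms_mono B s (le_max_right _ _) _ hm'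
          · exact conjTerms_mono B s (le_max_left _ _) _ (hm q hq)
      exact prod_ne_of_conjTerms (fun i => (hB i).1) hBmono (fun i => (hB i).2.1) hsB hxB
        (fun m => hpickF _ (hB m).2.2.1 (hB m).2.2.2 _) m k hy l hm hw hprod
    · refine ⟨0, ?_⟩
      rintro ⟨l, hl, -, rfl⟩
      refine hyH (list_prod_mem ?_)
      simp only [List.mem_map]
      rintro _ ⟨p, hp, rfl⟩
      exact hAH _ (hl p hp)
  obtain ⟨t, ht, ht2, hU⟩ := exists_groupTopology_of_smallProducts hAinv hAconj hsep
  refine ⟨t, ht, ht2, fun U hU' => ?_⟩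
  obtain ⟨k, hk⟩ := hU U hU'
  refine ⟨s (k + 1), hpickS (B (k + 1)) (hB (k + 1)).2.2.1 (hB (k + 1)).2.2.2 _,
    hk ⟨[(k + 1, s (k + 1))], ?_, ?_, ?_⟩⟩
  · rintro p hp
    rw [List.mem_singleton.1 hp]
    exact ⟨k + 2, 0, by simp, 1, (hB 0).1, Or.inl (by simp)⟩
  · rw [listWeight_cons, listWeight_nil, add_zero]
    exact pow_lt_pow_right_of_lt_one₀ (by norm_num) (by norm_num) (Nat.lt_succ_self k)
  · simp

end Sequence

/-! ### Reflection to countable subgroups -/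

section Reflection

/-- A Löwenheim–Skolem argument: if `Φ` assigns countably many elements to each finite set, then some
countable set is closed under `Φ`. -/
theorem exists_countable_closed_under {α : Type*} (Φ : Set α → Set α)
    (hΦ : ∀ t, t.Finite → (Φ t).Countable) :
    ∃ X : Set α, X.Countable ∧ ∀ t, t.Finite → t ⊆ X → Φ t ⊆ X := by
  let X : ℕ → Set α := fun n => Nat.rec ∅ (fun _ Y => Y ∪ ⋃ t ∈ {t | t.Finite ∧ t ⊆ Y}, Φ t) n
  have hsucc : ∀ n, X (n + 1) = X n ∪ ⋃ t ∈ {t | t.Finite ∧ t ⊆ X n}, Φ t := fun n => rfl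
  have hmono : Monotone X := monotone_nat_of_le_succ fun n => by
    rw [hsucc]
    exact Set.subset_union_left
  have hcount : ∀ n, (X n).Countable := by
    intro n
    induction n with
    | zero => exact Set.countable_empty
    | succ n ih =>
      rw [hsucc]
      exact ih.union ((Set.countable_ofPred_finite_subset ih).biUnion fun t ht => hΦ t ht.1)
  refine ⟨⋃ n, X n, Set.countable_iUnion hcount, fun t ht htX => ?_⟩
  obtain ⟨n, hn⟩ : ∃ n, t ⊆ X n := by
    induction t, ht using Set.Finite.induction_on with
    | empty => exact ⟨0, Set.empty_subset _⟩
    | @insert a t _ _ ih =>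
      obtain ⟨n, hn⟩ := ih ((Set.subset_insert a t).trans htX)
      obtain ⟨m, hm⟩ := Set.mem_iUnion.1 (htX (Set.mem_insert a t))
      exact ⟨max n m, Set.insert_subset (hmono (le_max_right _ _) hm)
        (hn.trans (hmono (le_max_left _ _)))⟩
  refine Set.Subset.trans ?_ (Set.subset_iUnion X (n + 1))
  rw [hsucc]
  exact Set.subset_union_of_subset_right
    (Set.subset_biUnion_of_mem (u := Φ) (show t ∈ {t | t.Finite ∧ t ⊆ X n} from ⟨ht, hn⟩)) _

variable {G : Type*} [Group G]

theorem exists_countable_subgroup_closed_under (Φ : Set G → Set G)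
    (hΦ : ∀ t, t.Finite → (Φ t).Countable) :
    ∃ H : Subgroup G, (H : Set G).Countable ∧ ∀ t : Set G, t.Finite → t ⊆ H → Φ t ⊆ H := by
  obtain ⟨X, hX, hcl⟩ := exists_countable_closed_under (fun t => Φ t ∪ ({1} ∪ (t * t ∪ t⁻¹)))
    fun t ht => (hΦ t ht).union
      ((Set.countable_singleton 1).union ((ht.mul ht).union ht.inv).countable)
  refine ⟨⟨⟨⟨X, ?_⟩, ?_⟩, ?_⟩, hX, fun t ht htX => Set.subset_union_left.trans (hcl t ht htX)⟩
  · intro a b ha hb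
    exact hcl {a, b} (by simp) (Set.insert_subset ha (Set.singleton_subset_iff.2 hb))
      (Or.inr (Or.inr (Or.inl ⟨a, by simp, b, by simp, rfl⟩)))
  · exact hcl ∅ Set.finite_empty (Set.empty_subset _) (Or.inr (Or.inl rfl))
  · intro a ha
    exact hcl {a} (by simp) (Set.singleton_subset_iff.2 ha) (Or.inr (Or.inr (Or.inr (by simp))))

/-- Suppose that every subgroup closed under the finitary countably-valued operation `Φ` induces on
itself, by conjugation with elements of `G`, only its own inner automorphisms. Then the
unconditionally closed subsets of `G` are algebraic. -/
theorem IsUnconditionallyClosed.isAlgebraicSet_of_closed_under (Φ : Set G → Set G)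
    (hΦ : ∀ t, t.Finite → (Φ t).Countable)
    (hinner : ∀ H : Subgroup G, (∀ t : Set G, t.Finite → t ⊆ H → Φ t ⊆ H) →
      ∀ g, ∃ h ∈ H, ∀ y ∈ H, g * y * g⁻¹ = h * y * h⁻¹)
    {S : Set G} (hS : IsUnconditionallyClosed S) : IsAlgebraicSet S := by
  by_contra hSa
  obtain ⟨x, hxS, hx⟩ := exists_notMem_forall_algebraic hSa
  have hpick : ∀ t : Set G, t.Finite → ∀ n : ℕ, ∃ y, x * y ∈ S ∧
      ∀ F ∈ wordGenerators t ^ n, F 1 ≠ 1 → F y ≠ 1 := fun t ht n =>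
    exists_mem_forall_wordFunction_ne_one hx (finite_pow_wordGenerators ht n)
      (pow_wordGenerators_subset t n)
  choose! pick hpickS hpickF using hpick
  obtain ⟨H, hH, hcl⟩ := exists_countable_subgroup_closed_under
    (fun t => Φ t ∪ Set.range (pick t)) fun t ht => (hΦ t ht).union (Set.countable_range _)
  obtain ⟨t, ht, ht2, hacc⟩ := exists_groupTopology_one_mem_closure
    (S := {y | x * y ∈ S}) hH
    (hinner H fun t ht htH => Set.subset_union_left.trans (hcl t ht htH))
    fun t ht htH n => ⟨pick t n, hpickS t ht n, hcl t ht htH (Or.inr ⟨n, rfl⟩), hpickF t ht n⟩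
  have hclosed : IsClosed[t] {y | x * y ∈ S} := (hS t ht ht2).preimage (continuous_const_mul x)
  obtain ⟨y, hy, hy'⟩ := hacc _ (hclosed.isOpen_compl.mem_nhds (by simpa using hxS))
  exact hy' hy

theorem groupMarkovTopology_eq_groupZariskiTopology
    (h : ∀ S : Set G, IsUnconditionallyClosed S → IsAlgebraicSet S) :
    groupMarkovTopology G = groupZariskiTopology G :=
  TopologicalSpace.ext_iff_isClosed.2 fun S => by
    rw [isClosed_groupMarkovTopology_iff, isClosed_groupZariskiTopology_iff]
    exact ⟨h S, IsAlgebraicSet.isUnconditionallyClosed⟩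

end Reflection

/-! ### Direct sums of countable groups -/

section DirectSum

variable {I : Type*} {D : I → Type*} [∀ i, Group (D i)]

/-- The elements of the direct sum whose support is contained in the union of the supports of the
members of `t`. -/
def supportSpan (t : Set (groupDirectSum D)) : Set (groupDirectSum D) :=
  {y | ∀ i, y.1 i ≠ 1 → ∃ z ∈ t, z.1 i ≠ 1}

theorem countable_supportSpan [∀ i, Countable (D i)] {t : Set (groupDirectSum D)}
    (ht : t.Finite) : (supportSpan t).Countable := by
  have hK : (⋃ z ∈ t, {i | z.1 i ≠ 1}).Finite := ht.biUnion fun z _ => z.2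
  have := hK.to_subtype
  let r : groupDirectSum D → ∀ i : (⋃ z ∈ t, {i | z.1 i ≠ 1} : Set I), D i := fun y i => y.1 i
  refine Set.MapsTo.countable_of_injOn (Set.mapsTo_univ r _) ?_ Set.countable_univ
  have hout : ∀ y ∈ supportSpan t, ∀ i ∉ (⋃ z ∈ t, {i | z.1 i ≠ 1}), y.1 i = 1 := by
    intro y hy i hi
    by_contra hne
    obtain ⟨z, hz, hzi⟩ := hy i hne
    exact hi (Set.mem_biUnion hz hzi)
  intro y hy y' hy' hr
  ext i
  by_cases hi : i ∈ ⋃ z ∈ t, {i | z.1 i ≠ 1}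
  · exact congrFun hr ⟨i, hi⟩
  · rw [hout y hy i hi, hout y' hy' i hi]

/-- If a subset `X` of the direct sum contains everything supported in finitely many supports of its
members, then conjugation on `X` by any `g` agrees with conjugation by the restriction of `g` to the
union of those supports, which lies in `X`. -/
theorem exists_mem_conj_eq {X : Set (groupDirectSum D)}
    (hX : ∀ t, t.Finite → t ⊆ X → supportSpan t ⊆ X) (g : groupDirectSum D) :
    ∃ h ∈ X, ∀ y ∈ X, g * y * g⁻¹ = h * y * h⁻¹ := by
  classical
  let h : groupDirectSum D := ⟨fun i => if ∃ z ∈ X, z.1 i ≠ 1 then g.1 i else 1,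
    g.2.subset fun i hi => by
      by_contra hgi
      simp only [Set.mem_ofPred_eq, not_not] at hgi
      simp [hgi] at hi⟩
  have hex : ∀ i : {i | h.1 i ≠ 1}, ∃ z ∈ X, z.1 i ≠ 1 := by
    rintro ⟨i, hi⟩
    by_contra hcon
    exact hi (if_neg hcon)
  choose z hzX hz using hex
  have hfin : Finite {i | h.1 i ≠ 1} := h.2.to_subtype
  refine ⟨h, hX (Set.range z) (Set.finite_range z) (Set.range_subset_iff.2 hzX)
    fun i hi => ⟨z ⟨i, hi⟩, ⟨_, rfl⟩, hz ⟨i, hi⟩⟩, fun y hy => ?_⟩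
  ext i
  by_cases hi : ∃ z ∈ X, z.1 i ≠ 1
  · have : h.1 i = g.1 i := if_pos hi
    simp [this]
  · have : y.1 i = 1 := by
      by_contra hne
      exact hi ⟨y, hy, hne⟩
    simp [this]

/-- The reflection argument for a group `G` mapping onto the direct sum with central kernel by a
homomorphism with a section. -/
theorem IsUnconditionallyClosed.isAlgebraicSet_of_split [∀ i, Countable (D i)] {G : Type*} [Group G]
    (π : G →* groupDirectSum D) (σ : groupDirectSum D → G) (hσ : ∀ y, π (σ y) = y)
    (hπ : ∀ g h y : G, π (g * y * g⁻¹) = π (h * y * h⁻¹) → g * y * g⁻¹ = h * y * h⁻¹)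
    {S : Set G} (hS : IsUnconditionallyClosed S) : IsAlgebraicSet S := by
  refine hS.isAlgebraicSet_of_closed_under (fun t => σ '' supportSpan (π '' t))
    (fun t ht => (countable_supportSpan (ht.image π)).image σ) fun H hH g => ?_
  obtain ⟨h, ⟨h', hh', rfl⟩, hconj⟩ := exists_mem_conj_eq (X := π '' H) (fun t ht htX => by
    obtain ⟨u, huH, hu, rfl⟩ :=
      Set.exists_subset_image_finite_and.1 ⟨t, htX, ht, (rfl : t = t)⟩
    intro y hy
    exact ⟨σ y, hH u hu huH ⟨y, hy, rfl⟩, hσ y⟩) (π g)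
  exact ⟨h', hh', fun y hy => hπ _ _ _ (by simpa using hconj (π y) ⟨y, hy, rfl⟩)⟩

end DirectSum

theorem corollary4p7 {N : Type*} [CommGroup N] {I : Type*} (G : I → Type*)
    [∀ i, Group (G i)] [∀ i, Countable (G i)] :
    (groupMarkovTopology (N × groupDirectSum G) = groupZariskiTopology (N × groupDirectSum G) ∧
      ∀ S : Set (N × groupDirectSum G), IsUnconditionallyClosed S → IsAlgebraicSet S) ∧
    (groupMarkovTopology (groupDirectSum G) = groupZariskiTopology (groupDirectSum G) ∧
      ∀ S : Set (groupDirectSum G), IsUnconditionallyClosed S → IsAlgebraicSet S) := by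
  have h₁ : ∀ S : Set (N × groupDirectSum G), IsUnconditionallyClosed S → IsAlgebraicSet S :=
    fun S hS => hS.isAlgebraicSet_of_split (MonoidHom.snd N (groupDirectSum G)) (fun y => (1, y))
      (fun _ => rfl) fun g h y hy => Prod.ext (by simp) hy
  have h₂ : ∀ S : Set (groupDirectSum G), IsUnconditionallyClosed S → IsAlgebraicSet S :=
    fun S hS => hS.isAlgebraicSet_of_split (MonoidHom.id _) id (fun _ => rfl) fun g h y hy => hy
  exact ⟨⟨groupMarkovTopology_eq_groupZariskiTopology h₁, h₁⟩,
    groupMarkovTopology_eq_groupZariskiTopology h₂, h₂⟩
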